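/- Let $E=\bigcup_{n=1}^{N}[\alpha_n,\beta_n]\subset\mathbb R$ be a finite gap set, where $N\ge 1$ and $\alpha_1<\beta_1<\alpha_2<\cdots<\alpha_N<\beta_N$, and let $\partial E=\{\alpha_n,\beta_n\}_{n=1}^N$ be the set of its endpoints. A probability measure $\rho$ on $\mathbb R$ supported on $E$ is called reflectionless on $E$ if its $m$-function $m(z)=\int_E \frac{d\rho(t)}{t-z}$, $z\in\mathbb C\setminus E$, has a boundary value $m(x+i0)=\lim_{y\downarrow 0}m(x+iy)$ with $\operatorname{Re} m(x+i0)=0$ for Lebesgue-almost every $x\in E$. Then for every $p>1$ there is a constant $K_{p,E}$, depending only on $p$ and $E$, such that for every reflectionless probability measure $\rho$ on $E$, $$\int_E \frac{d\rho(t)}{|t-z|^p}\le \frac{K_{p,E}}{\operatorname{dist}(z,E)^{p-1}\,\operatorname{dist}(z,\partial E)^{1/2}\,(1+|z|)^{1/2}},\qquad z\in\mathbb C\setminus E.$$ In addition, for every $\varepsilon>0$ there is a constant $K_{\varepsilon,E}$, depending only on $\varepsilon$ and $E$, such that for every reflectionless probability measure $\rho$ on $E$, $$\int_E \frac{d\rho(t)}{|t-z|}\le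 \frac{K_{\varepsilon,E}}{\operatorname{dist}(z,E)^{\varepsilon}\,\operatorname{dist}(z,\partial E)^{1/2}\,(1+|z|)^{1/2-\varepsilon}},\qquad z\in\mathbb C\setminus E.$$ -/

import Mathlib

open MeasureTheory Filter Topology

/-- A finite gap set, given by its bands: `N ≥ 1` disjoint, nondegenerate compact intervals
`[α n, β n]` of the real line, listed from left to right. -/
structure FiniteGapSet where
  /-- the number of bands -/
  N : ℕ
  one_le_N : 1 ≤ N
  /-- the left endpoints -/
  α : Fin N → ℝ
  /-- the right endpoints -/
  β : Fin N → ℝ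
  α_lt_β : ∀ n, α n < β n
  β_lt_α : ∀ m n, m < n → β m < α n

namespace FiniteGapSet

/-- The finite gap set as a subset of the real line. -/
def carrier (E : FiniteGapSet) : Set ℝ := ⋃ n, Set.Icc (E.α n) (E.β n)

/-- The set of all endpoints of the bands. -/
def endpoints (E : FiniteGapSet) : Set ℝ := Set.range E.α ∪ Set.range E.β

/-- The finite gap set as a subset of the complex plane. -/
def complexCarrier (E : FiniteGapSet) : Set ℂ := (fun t : ℝ => (t : ℂ)) '' E.carrier

/-- The endpoints of the bands as a subset of the complex plane. -/
def complexEndpoints (E : FiniteGapSet) : Set ℂ := (fun t : ℝ => (t : ℂ)) '' E.endpoints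

/-- The `m`-function `m(z) = ∫_E dρ(t) / (t - z)`. -/
noncomputable def mFunction (E : FiniteGapSet) (ρ : Measure ℝ) (z : ℂ) : ℂ :=
  ∫ t in E.carrier, 1 / ((t : ℂ) - z) ∂ρ

/-- `ρ` is reflectionless on `E`: for Lebesgue-almost every `x ∈ E` the boundary value
`m(x + i0) = lim_{y ↓ 0} m(x + iy)` is purely imaginary. -/
def IsReflectionless (E : FiniteGapSet) (ρ : Measure ℝ) : Prop :=
  ∀ᵐ x : ℝ ∂(volume.restrict E.carrier), ∃ l : ℂ,
    Tendsto (fun y : ℝ => E.mFunction ρ ((x : ℂ) + (y : ℂ) * Complex.I)) (𝓝[>] 0) (𝓝 l) ∧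
      l.re = 0

end FiniteGapSet

/-! Write `m` for the transform of `ρ`, and let `e` lie in a band `[α, β]`. The function `w = 1 - i
m` has real part `1 + Im m ≥ 1` on the upper half-plane, so `log w` is holomorphic there and its
imaginary part is at most `π / 2` in absolute value. Where `m(x + i0)` is purely imaginary, `w` has
a positive real boundary value, so `Im log w` tends to zero almost everywhere on the band.

The conjugate Poisson formula recovers `log |w|` at `e + i y`, relative to its value at `e + i`,
from the boundary values of `Im log w`. Only the complement of the band contributes, and the kernel
integrated over it has logarithmic singularities at the two endpoints
(`re_sub_re_le_of_im_tendsto_zero`). The bound `π / 2` makes their coefficient `1 / 2` in the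
distance, so exponentiating gives `Im m(e + i s) ≤ B` for every `s ≥ d`, with `B` of order `δ ^
(-1/2)`, where `δ` bounds the distance from `e + i d` to the endpoints from below
(`resolventTransform_im_le_rpow`).

Since `Im m(e + i s)` is a Poisson integral of `ρ`, averaging over heights `s > d` with weight `s ^
(-p)` turns this into a bound `B / d ^ (p - 1)` for the integral of `|t - e - i d| ^ (-p)`
(`lintegral_rpow_neg_le_of_poisson_le`). A point `z` close to `E` is compared with `e + i d`, where
`e` is a nearest point of `E` and `d = dist(z, E)`; away from `E` crude bounds suffice. The second
estimate follows from the first with `p = 1 + ε`. -/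

/-! ### Contour integration and the conjugate Poisson formula -/

/-- A holomorphic function near the closed upper half-plane which decays quadratically has
integral zero over the real line. -/
theorem integral_real_eq_zero_of_norm_le {G : ℂ → ℂ} {U : Set ℂ} (hU : {z : ℂ | 0 ≤ z.im} ⊆ U)
    (hG : DifferentiableOn ℂ G U) {C R : ℝ}
    (hC : ∀ z : ℂ, 0 ≤ z.im → R ≤ ‖z‖ → ‖G z‖ ≤ C / ‖z‖ ^ 2)
    (hint : Integrable fun t : ℝ => G t) : ∫ t : ℝ, G t = 0 := by
  have h1 : Tendsto (fun T : ℝ => ∫ t in (-T)..T, G t) atTop (𝓝 (∫ t : ℝ, G t)) :=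
    intervalIntegral_tendsto_integral hint tendsto_neg_atTop_atBot tendsto_id
  have h2 : Tendsto (fun T : ℝ => ∫ t in (-T)..T, G t) atTop (𝓝 0) := by
    -- The three other sides of the square over `[-T, T] × [0, T]` have total length `4 T`, and the
    -- integrand there is at most `|C| / T ^ 2`.
    have h3 : Tendsto (fun T : ℝ => 4 * |C| * T⁻¹) atTop (𝓝 0) := by
      simpa using tendsto_inv_atTop_zero.const_mul (4 * |C|)
    refine squeeze_zero_norm' ?_ h3
    filter_upwards [eventually_ge_atTop (max R 1)] with T hT
    have hTR : R ≤ T := le_trans (le_max_left _ _) hT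
    have hT1 : 1 ≤ T := le_trans (le_max_right _ _) hT
    have hT0 : 0 < T := by linarith
    have hb : ∀ z : ℂ, 0 ≤ z.im → T ≤ ‖z‖ → ‖G z‖ ≤ |C| / T ^ 2 := by
      intro z hz hzT
      refine (hC z hz (hTR.trans hzT)).trans ?_
      have : C / ‖z‖ ^ 2 ≤ |C| / ‖z‖ ^ 2 := by gcongr; exact le_abs_self C
      refine this.trans ?_
      gcongr
    have h := Complex.integral_boundary_rect_eq_zero_of_differentiableOn G
      (⟨-T, 0⟩ : ℂ) (⟨T, T⟩ : ℂ) (hG.mono (by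
        intro z hz
        apply hU
        have := hz.2
        simp only [Set.mem_preimage, Set.uIcc_of_le hT0.le] at this
        exact this.1))
    simp only [Complex.ofReal_zero, zero_mul, add_zero, smul_eq_mul] at h
    have e1 : ‖∫ x : ℝ in (-T)..T, G (x + T * Complex.I)‖ ≤ |C| / T ^ 2 * |T - -T| := by
      refine intervalIntegral.norm_integral_le_of_norm_le_const fun x _ => hb _ ?_ ?_
      · simp [hT0.le]
      · have := Complex.abs_im_le_norm ((x : ℂ) + T * Complex.I)
        simp [abs_of_pos hT0] at this
        exact this
    have e2 : ‖∫ y : ℝ in (0:ℝ)..T, G (T + y * Complex.I)‖ ≤ |C| / T ^ 2 * |T - 0| := by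
      refine intervalIntegral.norm_integral_le_of_norm_le_const fun x hx => hb _ ?_ ?_
      · rw [Set.uIoc_of_le hT0.le] at hx
        simp [hx.1.le]
      · have := Complex.abs_re_le_norm ((T : ℂ) + x * Complex.I)
        simp [abs_of_pos hT0] at this
        exact this
    have e3 : ‖∫ y : ℝ in (0:ℝ)..T, G ((-T : ℝ) + y * Complex.I)‖ ≤ |C| / T ^ 2 * |T - 0| := by
      refine intervalIntegral.norm_integral_le_of_norm_le_const fun x hx => hb _ ?_ ?_
      · rw [Set.uIoc_of_le hT0.le] at hx
        simp [hx.1.le]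
      · have := Complex.abs_re_le_norm (((-T : ℝ) : ℂ) + x * Complex.I)
        simp [abs_of_pos hT0] at this
        simpa using this
    have h' : (∫ t in (-T)..T, G t) = (∫ x : ℝ in (-T)..T, G (x + T * Complex.I)) -
        Complex.I * (∫ y : ℝ in (0:ℝ)..T, G (T + y * Complex.I)) +
        Complex.I * (∫ y : ℝ in (0:ℝ)..T, G ((-T : ℝ) + y * Complex.I)) := by
      linear_combination h
    rw [h']
    refine (norm_add_le _ _).trans ?_
    refine (add_le_add (norm_sub_le _ _) le_rfl).trans ?_
    simp only [norm_mul, Complex.norm_I, one_mul]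
    refine (add_le_add (add_le_add e1 e2) e3).trans (le_of_eq ?_)
    rw [abs_of_pos (by linarith : 0 < T - -T), abs_of_pos (by linarith : 0 < T - 0)]
    field_simp
    ring
  exact tendsto_nhds_unique h1 h2

/-- Two distinct zeros of a holomorphic function can be divided out. -/
theorem DifferentiableOn.exists_eq_mul_of_two_zeros {N : ℂ → ℂ} {U : Set ℂ} (hU : IsOpen U)
    (hN : DifferentiableOn ℂ N U) {a b : ℂ} (ha : a ∈ U) (hb : b ∈ U) (hab : a ≠ b)
    (hNa : N a = 0) (hNb : N b = 0) :
    ∃ q : ℂ → ℂ, DifferentiableOn ℂ q U ∧ ∀ z, N z = (z - a) * (z - b) * q z := by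
  have h1 : ∀ z, (z - a) * dslope N a z = N z := fun z => by
    have := sub_smul_dslope N a z
    simpa [hNa] using this
  have hb0 : dslope N a b = 0 := by
    have := h1 b
    rw [hNb] at this
    rcases mul_eq_zero.1 this with h | h
    · exact absurd (sub_eq_zero.1 h).symm hab
    · exact h
  refine ⟨dslope (dslope N a) b, ?_, fun z => ?_⟩
  · exact (Complex.differentiableOn_dslope (hU.mem_nhds hb)).2
      ((Complex.differentiableOn_dslope (hU.mem_nhds ha)).2 hN)
  · have := sub_smul_dslope (dslope N a) b z
    rw [hb0, sub_zero, smul_eq_mul] at this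
    rw [mul_assoc, this, h1]

theorem integral_real_inv_sq_add_sq {y : ℝ} (hy : 0 < y) :
    Integrable (fun t : ℝ => (t ^ 2 + y ^ 2)⁻¹) ∧
      ∫ t : ℝ, (t ^ 2 + y ^ 2)⁻¹ = Real.pi / y := by
  have e : (fun t : ℝ => (t ^ 2 + y ^ 2)⁻¹) = fun t => (y ^ 2)⁻¹ * (1 + (t / y) ^ 2)⁻¹ := by
    funext t
    rw [← mul_inv]
    congr 1
    field_simp
    ring
  rw [e]
  constructor
  · exact (integrable_inv_one_add_sq.comp_div hy.ne').const_mul _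
  · rw [integral_const_mul, Measure.integral_comp_div (fun x : ℝ => (1 + x ^ 2)⁻¹) y,
      integral_univ_inv_one_add_sq, abs_of_pos hy, smul_eq_mul]
    field_simp

/-- The difference of the conjugate Poisson kernels at heights `y` and `1`. -/
noncomputable def conjPoissonDiff (y t : ℝ) : ℝ :=
  t * (1 - y ^ 2) / ((t ^ 2 + y ^ 2) * (t ^ 2 + 1))

theorem abs_conjPoissonDiff_le {y : ℝ} (hy : 0 < y) (hy1 : y < 1) (t : ℝ) :
    |conjPoissonDiff y t| ≤ (2 * y)⁻¹ * (1 + t ^ 2)⁻¹ := by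
  have h0 : 0 < 1 - y ^ 2 := by nlinarith
  have h2 : 0 < t ^ 2 + y ^ 2 := by positivity
  rw [conjPoissonDiff, abs_div, abs_mul, abs_of_pos h0,
    abs_of_pos (by positivity : 0 < (t ^ 2 + y ^ 2) * (t ^ 2 + 1)), ← mul_inv, ← one_div,
    div_le_div_iff₀ (by positivity) (by positivity)]
  have h3 : 2 * y * |t| ≤ t ^ 2 + y ^ 2 := by
    nlinarith [sq_nonneg (|t| - y), sq_abs t]
  have h4 : |t| * (1 - y ^ 2) ≤ |t| := by nlinarith [abs_nonneg t, sq_nonneg y]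
  calc |t| * (1 - y ^ 2) * (2 * y * (1 + t ^ 2)) ≤ |t| * (2 * y * (1 + t ^ 2)) := by gcongr
    _ = (2 * y * |t|) * (1 + t ^ 2) := by ring
    _ ≤ (t ^ 2 + y ^ 2) * (1 + t ^ 2) := by gcongr
    _ = _ := by ring

theorem continuous_conjPoissonDiff {y : ℝ} (hy : 0 < y) : Continuous (conjPoissonDiff y) := by
  unfold conjPoissonDiff
  refine Continuous.div (by fun_prop) (by fun_prop) fun t => ?_
  positivity

theorem integrable_conjPoissonDiff {y : ℝ} (hy : 0 < y) (hy1 : y < 1) :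
    Integrable (conjPoissonDiff y) :=
  (integrable_inv_one_add_sq.const_mul ((2 * y)⁻¹)).mono'
    (continuous_conjPoissonDiff hy).aestronglyMeasurable
    (Eventually.of_forall fun t => by
      rw [Real.norm_eq_abs]; exact abs_conjPoissonDiff_le hy hy1 t)

/-- Conjugate Poisson formula: the values of a bounded holomorphic function at `iy` and `i` differ
by its integral against the difference of the conjugate Poisson kernels. -/
theorem integral_mul_conjPoissonDiff {F : ℂ → ℂ} {U : Set ℂ} (hUo : IsOpen U)
    (hU : {z : ℂ | 0 ≤ z.im} ⊆ U) (hF : DifferentiableOn ℂ F U) {M : ℝ}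
    (hM : ∀ z : ℂ, 0 ≤ z.im → ‖F z‖ ≤ M) {y : ℝ} (hy : 0 < y) (hy1 : y < 1) :
    ∫ t : ℝ, F t * (conjPoissonDiff y t : ℂ) =
      Real.pi * Complex.I * (F (y * Complex.I) - F Complex.I) := by
  set A : ℂ := F (y * Complex.I) with hA
  set B : ℂ := F Complex.I with hB
  -- Multiples of the Poisson kernels at heights `y` and `1` are combined with `F` times the kernel
  -- to cancel its poles at `iy` and `i`. `N` is the numerator over `(z ^ 2 + y ^ 2) (z ^ 2 + 1)`
  -- and vanishes at both points.
  set N : ℂ → ℂ := fun z => F z * (z * (1 - y ^ 2)) - Complex.I * y * A * (z ^ 2 + 1)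
    + Complex.I * B * (z ^ 2 + y ^ 2) with hN
  have hI2 : Complex.I ^ 2 = -1 := Complex.I_sq
  have hmem : ∀ z : ℂ, 0 ≤ z.im → z ∈ U := fun z hz => hU hz
  obtain ⟨q, hq, hNq⟩ := DifferentiableOn.exists_eq_mul_of_two_zeros (N := N) hUo
    (a := y * Complex.I) (b := Complex.I)
    (((hF.mul (by fun_prop)).sub (by fun_prop)).add (by fun_prop))
    (hmem _ (by simp [hy.le])) (hmem _ (by simp)) (by
      intro h
      have := congrArg Complex.im h
      simp at this
      exact hy1.ne this)
    (by simp only [hN, ← hA, mul_pow, hI2]; ring)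
    (by simp only [hN, ← hB, hI2]; ring)
  have hM0 : 0 ≤ M := (norm_nonneg _).trans (hM 0 (by simp))
  have hne1 : ∀ z : ℂ, 0 ≤ z.im → z + y * Complex.I ≠ 0 := fun z hz h => by
    have := congrArg Complex.im h
    simp at this
    linarith
  have hne2 : ∀ z : ℂ, 0 ≤ z.im → z + Complex.I ≠ 0 := fun z hz h => by
    have := congrArg Complex.im h
    simp at this
    linarith
  set G : ℂ → ℂ := fun z => q z / ((z + y * Complex.I) * (z + Complex.I)) with hG
  have hyc : (0 : ℝ) < y ^ 2 := by positivity
  have hsq1 : ∀ t : ℝ, (t : ℂ) ^ 2 + (y : ℂ) ^ 2 ≠ 0 := fun t => by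
    have : t ^ 2 + y ^ 2 ≠ 0 := by positivity
    exact_mod_cast this
  have hsq2 : ∀ t : ℝ, (t : ℂ) ^ 2 + 1 ≠ 0 := fun t => by
    have : t ^ 2 + 1 ≠ 0 := by positivity
    exact_mod_cast this
  have hGt' : ∀ z : ℂ, 0 ≤ z.im → z ^ 2 + (y : ℂ) ^ 2 ≠ 0 → z ^ 2 + 1 ≠ 0 →
      G z = N z / ((z ^ 2 + y ^ 2) * (z ^ 2 + 1)) := by
    intro z hz h1 h2
    rw [hG, hNq z]
    have h3 := hne1 z hz
    have h4 := hne2 z hz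
    have e1 : z ^ 2 + (y : ℂ) ^ 2 = (z - y * Complex.I) * (z + y * Complex.I) := by
      ring_nf; rw [hI2]; ring
    have e2 : z ^ 2 + 1 = (z - Complex.I) * (z + Complex.I) := by
      ring_nf; rw [hI2]; ring
    rw [e1] at h1 ⊢
    rw [e2] at h2 ⊢
    have h5 := left_ne_zero_of_mul h1
    have h6 := left_ne_zero_of_mul h2
    field_simp
  have hGt : ∀ t : ℝ, G t = F t * (conjPoissonDiff y t : ℂ)
      - Complex.I * y * A * (((t ^ 2 + y ^ 2)⁻¹ : ℝ) : ℂ)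
      + Complex.I * B * (((t ^ 2 + 1 ^ 2)⁻¹ : ℝ) : ℂ) := by
    intro t
    have h1 := hsq1 t
    have h2 := hsq2 t
    rw [hGt' t (by simp) h1 h2, hN, conjPoissonDiff]
    push_cast
    rw [one_pow]
    field_simp
  have hFc : Continuous fun t : ℝ => F t :=
    hF.continuousOn.comp_continuous Complex.continuous_ofReal fun t => hmem _ (by simp)
  have i1 : Integrable fun t : ℝ => F t * (conjPoissonDiff y t : ℂ) :=
    (integrable_conjPoissonDiff hy hy1).ofReal.bdd_mul (c := M) hFc.aestronglyMeasurable
      (Eventually.of_forall fun t => hM _ (by simp))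
  have i2 : Integrable fun t : ℝ => Complex.I * y * A * (((t ^ 2 + y ^ 2)⁻¹ : ℝ) : ℂ) :=
    (integral_real_inv_sq_add_sq hy).1.ofReal.const_mul _
  have i3 : Integrable fun t : ℝ => Complex.I * B * (((t ^ 2 + 1 ^ 2)⁻¹ : ℝ) : ℂ) :=
    (integral_real_inv_sq_add_sq one_pos).1.ofReal.const_mul _
  have hzero : ∫ t : ℝ, G t = 0 := by
    -- For `‖z‖ ≥ 2` each factor of the denominator is at least `‖z‖ ^ 2 / 2`, which gives the `4`;
    -- the three terms of `N` contribute `1 + 2 + 2 = 5` times `M ‖z‖ ^ 2`.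
    refine integral_real_eq_zero_of_norm_le (U := {z : ℂ | 0 ≤ z.im}) subset_rfl
      (C := 4 * (5 * M)) (R := 2) ?_ ?_ ?_
    · refine (hq.mono hU).div (by fun_prop) fun z hz => mul_ne_zero (hne1 z hz) (hne2 z hz)
    · intro z hz hz2
      have hz0 : 0 < ‖z‖ := by linarith
      have key : ∀ c : ℝ, 0 < c → c ≤ 1 → ‖z‖ ^ 2 / 2 ≤ ‖z ^ 2 + (c : ℂ) ^ 2‖ ∧
          ‖z ^ 2 + (c : ℂ) ^ 2‖ ≤ 2 * ‖z‖ ^ 2 := by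
        intro c hc hc1
        have hcc : ‖(c : ℂ) ^ 2‖ = c ^ 2 := by simp [abs_of_pos hc]
        have hc2 : c ^ 2 ≤ 1 := by nlinarith
        constructor
        · have := norm_sub_norm_le (z ^ 2) (-(c : ℂ) ^ 2)
          rw [norm_neg, hcc, sub_neg_eq_add, norm_pow] at this
          nlinarith
        · refine (norm_add_le _ _).trans ?_
          rw [hcc, norm_pow]
          nlinarith
      have k1 := key y hy hy1.le
      have k2 := key 1 one_pos le_rfl
      rw [Complex.ofReal_one, one_pow] at k2
      have n1 : z ^ 2 + (y : ℂ) ^ 2 ≠ 0 := norm_pos_iff.1 (by nlinarith [k1.1])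
      have n2 : z ^ 2 + 1 ≠ 0 := norm_pos_iff.1 (by nlinarith [k2.1])
      rw [hGt' z hz n1 n2, norm_div, norm_mul, div_le_div_iff₀ (by positivity) (by positivity)]
      have hNb : ‖N z‖ ≤ 5 * M * ‖z‖ ^ 2 := by
        have hAM : ‖A‖ ≤ M := hM _ (by simp [hy.le])
        have hBM : ‖B‖ ≤ M := hM _ (by simp)
        have a1 : ‖F z * (z * (1 - (y : ℂ) ^ 2))‖ ≤ M * (‖z‖ * 1) := by
          rw [norm_mul, norm_mul]
          gcongr
          · exact hM z hz
          · have : (1 : ℂ) - (y : ℂ) ^ 2 = ((1 - y ^ 2 : ℝ) : ℂ) := by push_cast; ring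
            rw [this, Complex.norm_real, Real.norm_eq_abs, abs_of_pos (by nlinarith)]
            nlinarith
        have a2 : ‖Complex.I * y * A * (z ^ 2 + 1)‖ ≤ 1 * 1 * M * (2 * ‖z‖ ^ 2) := by
          rw [norm_mul, norm_mul, norm_mul]
          gcongr
          · simp
          · simp [abs_of_pos hy, hy1.le]
          · exact k2.2
        have a3 : ‖Complex.I * B * (z ^ 2 + (y : ℂ) ^ 2)‖ ≤ 1 * M * (2 * ‖z‖ ^ 2) := by
          rw [norm_mul, norm_mul]
          gcongr
          · simp
          · exact k1.2
        have := (norm_add_le _ _).trans (add_le_add ((norm_sub_le _ _).trans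
          (add_le_add a1 a2)) a3)
        refine this.trans ?_
        have : M * ‖z‖ ≤ M * ‖z‖ ^ 2 := by
          gcongr; nlinarith
        linarith
      have hprod : ‖z‖ ^ 2 / 2 * (‖z‖ ^ 2 / 2) ≤ ‖z ^ 2 + (y : ℂ) ^ 2‖ * ‖z ^ 2 + 1‖ :=
        mul_le_mul k1.1 k2.1 (by positivity) (norm_nonneg _)
      calc ‖N z‖ * ‖z‖ ^ 2 ≤ 5 * M * ‖z‖ ^ 2 * ‖z‖ ^ 2 := by gcongr
        _ = 4 * (5 * M) * (‖z‖ ^ 2 / 2 * (‖z‖ ^ 2 / 2)) := by ring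
        _ ≤ _ := by gcongr
    · simp only [hGt]
      exact (i1.sub i2).add i3
  simp only [hGt] at hzero
  have i12 : Integrable fun t : ℝ => F t * (conjPoissonDiff y t : ℂ)
      - Complex.I * y * A * (((t ^ 2 + y ^ 2)⁻¹ : ℝ) : ℂ) := i1.sub i2
  rw [integral_add i12 i3, integral_sub i1 i2, integral_const_mul, integral_const_mul,
    integral_complex_ofReal, integral_complex_ofReal, (integral_real_inv_sq_add_sq hy).2,
    (integral_real_inv_sq_add_sq one_pos).2] at hzero
  have hy' : (y : ℂ) ≠ 0 := by exact_mod_cast hy.ne'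
  push_cast at hzero
  field_simp at hzero
  linear_combination hzero

/-- The kernel is real and the right-hand side carries a factor `i`, so taking imaginary parts
expresses the real part of `F` through the boundary values of its imaginary part. -/
theorem integral_im_mul_conjPoissonDiff {F : ℂ → ℂ} {U : Set ℂ} (hUo : IsOpen U)
    (hU : {z : ℂ | 0 ≤ z.im} ⊆ U) (hF : DifferentiableOn ℂ F U) {M : ℝ}
    (hM : ∀ z : ℂ, 0 ≤ z.im → ‖F z‖ ≤ M) {y : ℝ} (hy : 0 < y) (hy1 : y < 1) :
    ∫ t : ℝ, (F t).im * conjPoissonDiff y t =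
      Real.pi * ((F (y * Complex.I)).re - (F Complex.I).re) := by
  have h := integral_mul_conjPoissonDiff hUo hU hF hM hy hy1
  have hFc : Continuous fun t : ℝ => F t :=
    hF.continuousOn.comp_continuous Complex.continuous_ofReal fun t => hU (by simp)
  have i1 : Integrable fun t : ℝ => F t * (conjPoissonDiff y t : ℂ) :=
    (integrable_conjPoissonDiff hy hy1).ofReal.bdd_mul (c := M) hFc.aestronglyMeasurable
      (Eventually.of_forall fun t => hM _ (by simp))
  have h2 := integral_im i1
  simp only [RCLike.im_eq_complex_im] at h2
  rw [h] at h2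
  simpa using h2

/-! ### Explicit integrals of the kernel -/

/-- By partial fractions the kernel is `t / (t ^ 2 + y ^ 2) - t / (t ^ 2 + 1)`; its logarithmic
antiderivative vanishes at infinity. -/
theorem setIntegral_Ioi_conjPoissonDiff {y b : ℝ} (hy : 0 < y) (hy1 : y < 1) :
    ∫ t in Set.Ioi b, conjPoissonDiff y t = 1 / 2 * Real.log ((b ^ 2 + 1) / (b ^ 2 + y ^ 2)) := by
  have hd : ∀ s ∈ Set.Ici b, HasDerivAt
      (fun s : ℝ => 1 / 2 * (Real.log (s ^ 2 + y ^ 2) - Real.log (s ^ 2 + 1)))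
      (conjPoissonDiff y s) s := by
    intro s _
    have h1 : HasDerivAt (fun s : ℝ => s ^ 2 + y ^ 2) (2 * s) s := by
      simpa using (hasDerivAt_pow 2 s).add_const (y ^ 2)
    have h2 : HasDerivAt (fun s : ℝ => s ^ 2 + 1) (2 * s) s := by
      simpa using (hasDerivAt_pow 2 s).add_const 1
    have h3 := ((h1.log (by positivity)).sub (h2.log (by positivity))).const_mul (1 / 2)
    refine h3.congr_deriv ?_
    unfold conjPoissonDiff
    have : s ^ 2 + y ^ 2 ≠ 0 := by positivity
    have : s ^ 2 + 1 ≠ 0 := by positivity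
    field_simp
    ring
  have hl : Tendsto (fun s : ℝ => 1 / 2 * (Real.log (s ^ 2 + y ^ 2) - Real.log (s ^ 2 + 1)))
      atTop (𝓝 0) := by
    have h1 : Tendsto (fun s : ℝ => s ^ 2 + 1) atTop atTop :=
      tendsto_atTop_add_const_right _ _ (tendsto_pow_atTop two_ne_zero)
    have h2 : Tendsto (fun s : ℝ => 1 - (1 - y ^ 2) * (s ^ 2 + 1)⁻¹) atTop (𝓝 1) := by
      simpa using tendsto_const_nhds.sub (h1.inv_tendsto_atTop.const_mul (1 - y ^ 2))
    have h3 := (h2.log one_ne_zero).const_mul (1 / 2)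
    rw [Real.log_one, mul_zero] at h3
    refine h3.congr fun s => ?_
    rw [← Real.log_div (by positivity) (by positivity)]
    congr 2
    have : s ^ 2 + 1 ≠ 0 := by positivity
    field_simp
    ring
  rw [integral_Ioi_of_hasDerivAt_of_tendsto' hd (integrable_conjPoissonDiff hy hy1).integrableOn
    hl, Real.log_div (by positivity) (by positivity)]
  ring

theorem conjPoissonDiff_neg (y t : ℝ) : conjPoissonDiff y (-t) = -conjPoissonDiff y t := by
  simp only [conjPoissonDiff, even_two.neg_pow]
  ring

theorem conjPoissonDiff_nonneg {y t : ℝ} (hy : 0 < y) (hy1 : y < 1) (ht : 0 ≤ t) :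
    0 ≤ conjPoissonDiff y t := by
  have : 0 ≤ 1 - y ^ 2 := by nlinarith
  unfold conjPoissonDiff
  positivity

/-- The kernel is odd and nonnegative on the right half-line, so both tails reduce to the one-sided
integral. -/
theorem setIntegral_compl_Icc_abs_conjPoissonDiff {y a b : ℝ} (hy : 0 < y) (hy1 : y < 1)
    (ha : 0 ≤ a) (hb : 0 ≤ b) :
    ∫ t in (Set.Icc (-a) b)ᶜ, |conjPoissonDiff y t| =
      1 / 2 * (Real.log ((a ^ 2 + 1) / (a ^ 2 + y ^ 2)) +
        Real.log ((b ^ 2 + 1) / (b ^ 2 + y ^ 2))) := by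
  have hI : ∀ c : ℝ, 0 ≤ c → ∫ t in Set.Ioi c, |conjPoissonDiff y t| =
      1 / 2 * Real.log ((c ^ 2 + 1) / (c ^ 2 + y ^ 2)) := by
    intro c hc
    rw [← setIntegral_Ioi_conjPoissonDiff hy hy1]
    refine setIntegral_congr_fun measurableSet_Ioi fun t ht => ?_
    exact abs_of_nonneg (conjPoissonDiff_nonneg hy hy1 (hc.trans (le_of_lt ht)))
  have hJ : ∫ t in Set.Iio (-a), |conjPoissonDiff y t| =
      1 / 2 * Real.log ((a ^ 2 + 1) / (a ^ 2 + y ^ 2)) := by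
    rw [← hI a ha, ← integral_Iic_eq_integral_Iio,
      ← integral_comp_neg_Ioi a (fun t => |conjPoissonDiff y t|)]
    simp only [conjPoissonDiff_neg, abs_neg]
  have hset : (Set.Icc (-a) b)ᶜ = Set.Iio (-a) ∪ Set.Ioi b := by
    ext t
    simp only [Set.mem_compl_iff, Set.mem_Icc, Set.mem_union, Set.mem_Iio, Set.mem_Ioi]
    grind
  have hdis : Disjoint (Set.Iio (-a)) (Set.Ioi b) := by
    rw [Set.disjoint_left]
    intro t h1 h2
    simp only [Set.mem_Iio, Set.mem_Ioi] at h1 h2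
    linarith
  have hi := (integrable_conjPoissonDiff hy hy1).abs
  rw [hset, setIntegral_union hdis measurableSet_Ioi hi.integrableOn hi.integrableOn, hJ, hI b hb]
  ring

/-! ### Logarithmic growth towards a band -/

/-- If the imaginary part of a holomorphic function on the upper half-plane is at most `π / 2` and
has vanishing boundary values on `[-a, b]`, then its real part grows at most logarithmically in the
distance to the points `-a` and `b` along the imaginary axis. -/
theorem re_sub_re_le_of_im_tendsto_zero {F : ℂ → ℂ} (hF : DifferentiableOn ℂ F {z | 0 < z.im})
    (hM : ∀ η : ℝ, 0 < η → ∃ M : ℝ, ∀ z : ℂ, η ≤ z.im → ‖F z‖ ≤ M)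
    (him : ∀ z : ℂ, 0 < z.im → |(F z).im| ≤ Real.pi / 2)
    {a b : ℝ} (ha : 0 ≤ a) (hb : 0 ≤ b)
    (hlim : ∀ᵐ t : ℝ, t ∈ Set.Icc (-a) b →
      Tendsto (fun η : ℝ => (F (t + η * Complex.I)).im) (𝓝[>] 0) (𝓝 0))
    {y : ℝ} (hy : 0 < y) (hy1 : y < 1) :
    (F (y * Complex.I)).re - (F Complex.I).re ≤
      1 / 4 * (Real.log ((a ^ 2 + 1) / (a ^ 2 + y ^ 2)) +
        Real.log ((b ^ 2 + 1) / (b ^ 2 + y ^ 2))) := by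
  set S := Set.Icc (-a) b with hS
  have hSm : MeasurableSet S := measurableSet_Icc
  set K := conjPoissonDiff y with hK
  have hKi : Integrable K := integrable_conjPoissonDiff hy hy1
  have hshift : ∀ η : ℝ, 0 < η → Continuous fun t : ℝ => F (t + η * Complex.I) := fun η hη =>
    hF.continuousOn.comp_continuous (by fun_prop) fun t => by simp [hη]
  -- `F` need not extend to the real line, so the formula is applied to its translate by `iη`, and
  -- `η` tends to zero at the end.
  have hid : ∀ η : ℝ, 0 < η → ∫ t : ℝ, (F (t + η * Complex.I)).im * K t =
      Real.pi * ((F (y * Complex.I + η * Complex.I)).re -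
        (F (Complex.I + η * Complex.I)).re) := by
    intro η hη
    obtain ⟨M, hMη⟩ := hM η hη
    refine integral_im_mul_conjPoissonDiff (F := fun z => F (z + η * Complex.I))
      (U := {z | -η < z.im}) (isOpen_lt continuous_const Complex.continuous_im) ?_ ?_
      (M := M) ?_ hy hy1
    · intro z hz
      simp only [Set.mem_ofPred_eq] at hz ⊢
      linarith
    · refine hF.comp (by fun_prop) fun z hz => ?_
      simp only [Set.mem_ofPred_eq] at hz
      simp
      linarith
    · intro z hz
      apply hMη
      simp [hz]
  have hint : ∀ η : ℝ, 0 < η → Integrable fun t : ℝ => (F (t + η * Complex.I)).im * K t := by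
    intro η hη
    refine hKi.bdd_mul (c := Real.pi / 2)
      (Complex.continuous_im.comp (hshift η hη)).aestronglyMeasurable
      (Eventually.of_forall fun t => ?_)
    exact him _ (by simp [hη])
  have hle : ∀ η : ℝ, 0 < η → Real.pi * ((F (y * Complex.I + η * Complex.I)).re -
        (F (Complex.I + η * Complex.I)).re) ≤
      (∫ t in S, (F (t + η * Complex.I)).im * K t) + Real.pi / 2 * ∫ t in Sᶜ, |K t| := by
    intro η hη
    rw [← hid η hη, ← integral_add_compl hSm (hint η hη), ← integral_const_mul]
    refine add_le_add le_rfl ?_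
    refine setIntegral_mono_on (hint η hη).integrableOn
      (hKi.abs.const_mul _).integrableOn hSm.compl fun t _ => ?_
    refine (le_abs_self _).trans ?_
    rw [abs_mul]
    gcongr
    exact him _ (by simp [hη])
  have hcont : ∀ w : ℂ, 0 < w.im →
      Tendsto (fun η : ℝ => (F (w + η * Complex.I)).re) (𝓝[>] 0) (𝓝 (F w).re) := by
    intro w hw
    have h1 : ContinuousAt F w := (hF.differentiableAt
      ((isOpen_lt continuous_const Complex.continuous_im).mem_nhds hw)).continuousAt
    have h2 : Tendsto (fun η : ℝ => w + η * Complex.I) (𝓝[>] 0) (𝓝 w) := by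
      have : Continuous fun η : ℝ => w + η * Complex.I := by fun_prop
      have := (this.tendsto 0).mono_left (nhdsWithin_le_nhds (s := Set.Ioi 0))
      simpa using this
    exact (Complex.continuous_re.tendsto _).comp (h1.tendsto.comp h2)
  have hL : Tendsto (fun η : ℝ => Real.pi * ((F (y * Complex.I + η * Complex.I)).re -
        (F (Complex.I + η * Complex.I)).re)) (𝓝[>] 0)
      (𝓝 (Real.pi * ((F (y * Complex.I)).re - (F Complex.I).re))) :=
    ((hcont _ (by simp [hy])).sub (hcont _ (by simp))).const_mul _
  -- Dominated convergence, with majorant `π / 2 * |K|`, removes the contribution of the band.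
  have hR : Tendsto (fun η : ℝ => ∫ t in S, (F (t + η * Complex.I)).im * K t) (𝓝[>] 0) (𝓝 0) := by
    have h := tendsto_integral_filter_of_dominated_convergence (μ := volume.restrict S)
      (l := 𝓝[>] (0 : ℝ)) (F := fun (η : ℝ) (t : ℝ) => (F (t + η * Complex.I)).im * K t)
      (f := fun _ => 0) (fun t => Real.pi / 2 * |K t|) ?_ ?_ ?_ ?_
    · simpa using h
    · filter_upwards [self_mem_nhdsWithin] with η hη
      exact (hint η hη).aestronglyMeasurable.restrict
    · filter_upwards [self_mem_nhdsWithin] with η hη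
      refine Eventually.of_forall fun t => ?_
      rw [norm_mul, Real.norm_eq_abs, Real.norm_eq_abs]
      gcongr
      exact him _ (by simpa using hη)
    · exact (hKi.abs.const_mul _).restrict
    · rw [ae_restrict_iff' hSm]
      filter_upwards [hlim] with t ht hts
      simpa using (ht hts).mul_const (K t)
  have hfin := le_of_tendsto_of_tendsto hL (hR.add_const (Real.pi / 2 * ∫ t in Sᶜ, |K t|))
    (by filter_upwards [self_mem_nhdsWithin] with η hη using hle η hη)
  rw [zero_add, setIntegral_compl_Icc_abs_conjPoissonDiff hy hy1 ha hb] at hfin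
  have hpi := Real.pi_pos
  refine le_of_mul_le_mul_left (hfin.trans (le_of_eq ?_)) hpi
  ring

/-! ### Bounds for the transform of a reflectionless measure -/

section ResolventTransform

variable {μ : Measure ℝ}

theorem resolventTransform_eq_integral_inv (μ : Measure ℝ) (z : ℂ) :
    resolventTransform μ z = ∫ t : ℝ, ((t : ℂ) - z)⁻¹ ∂μ := by
  simp [resolventTransform_apply, resolvent]

theorem norm_inv_ofReal_sub_le {z : ℂ} (hz : 0 < z.im) (t : ℝ) : ‖((t : ℂ) - z)⁻¹‖ ≤ z.im⁻¹ := by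
  rw [norm_inv]
  gcongr
  have := Complex.abs_im_le_norm ((t : ℂ) - z)
  simpa [abs_of_pos hz] using this

theorem norm_resolventTransform_le [IsProbabilityMeasure μ] {z : ℂ} (hz : 0 < z.im) :
    ‖resolventTransform μ z‖ ≤ z.im⁻¹ := by
  rw [resolventTransform_eq_integral_inv]
  have := norm_integral_le_of_norm_le_const (μ := μ)
    (Eventually.of_forall fun t => norm_inv_ofReal_sub_le hz t)
  simpa using this

theorem integrable_inv_ofReal_sub [IsFiniteMeasure μ] {z : ℂ} (hz : 0 < z.im) :
    Integrable (fun t : ℝ => ((t : ℂ) - z)⁻¹) μ :=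
  Integrable.of_bound (by fun_prop) z.im⁻¹
    (Eventually.of_forall fun t => norm_inv_ofReal_sub_le hz t)

theorem resolventTransform_im [IsFiniteMeasure μ] {z : ℂ} (hz : 0 < z.im) :
    (resolventTransform μ z).im = ∫ t : ℝ, z.im / ((t - z.re) ^ 2 + z.im ^ 2) ∂μ := by
  rw [resolventTransform_eq_integral_inv]
  have := integral_im (integrable_inv_ofReal_sub (μ := μ) hz)
  simp only [RCLike.im_eq_complex_im] at this
  rw [← this]
  congr 1 with t
  rw [Complex.inv_im, Complex.normSq_apply]
  simp
  ring_nf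

theorem resolventTransform_im_nonneg [IsFiniteMeasure μ] {z : ℂ} (hz : 0 < z.im) :
    0 ≤ (resolventTransform μ z).im := by
  rw [resolventTransform_im hz]
  exact integral_nonneg fun t => by positivity

theorem differentiableOn_resolventTransform [IsFiniteMeasure μ] :
    DifferentiableOn ℂ (resolventTransform μ : ℂ → ℂ) {z | 0 < z.im} := by
  intro z hz
  refine (hasDerivAt_resolventTransform z ?_).differentiableAt.differentiableWithinAt
  rintro ⟨t, -, rfl⟩
  simp at hz

/-- If the transform of a probability measure has purely imaginary boundary values on
`[e - a, e + b]`, then its imaginary part above `e` is controlled by the distances to the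
endpoints of this interval. -/
theorem resolventTransform_im_le [IsProbabilityMeasure μ] {e a b : ℝ} (ha : 0 ≤ a) (hb : 0 ≤ b)
    (hrefl : ∀ᵐ x : ℝ, x ∈ Set.Icc (e - a) (e + b) → ∃ l : ℂ,
      Tendsto (fun y : ℝ => resolventTransform μ ((x : ℂ) + (y : ℂ) * Complex.I)) (𝓝[>] 0) (𝓝 l) ∧
        l.re = 0) {y : ℝ} (hy : 0 < y) (hy1 : y < 1) :
    (resolventTransform μ ((e : ℂ) + y * Complex.I)).im ≤
      2 * (((a ^ 2 + 1) / (a ^ 2 + y ^ 2)) * ((b ^ 2 + 1) / (b ^ 2 + y ^ 2))) ^ (1 / 4 : ℝ) := by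
  -- Adding `1` keeps `w` in `Re w ≥ 1`: its logarithm is then holomorphic, has nonnegative real
  -- part, and is bounded on each half-plane `Im z ≥ η`.
  set w : ℂ → ℂ := fun z => 1 - Complex.I * resolventTransform μ (e + z) with hw
  have hre : ∀ z : ℂ, (w z).re = 1 + (resolventTransform μ (e + z)).im := fun z => by
    simp [hw]
  have hre1 : ∀ z : ℂ, 0 < z.im → 1 ≤ (w z).re := fun z hz => by
    rw [hre]
    have := resolventTransform_im_nonneg (μ := μ) (z := e + z) (by simpa using hz)
    linarith
  have hnorm1 : ∀ z : ℂ, 0 < z.im → 1 ≤ ‖w z‖ := fun z hz =>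
    (hre1 z hz).trans (Complex.re_le_norm _)
  have hnorm2 : ∀ z : ℂ, 0 < z.im → ‖w z‖ ≤ 1 + z.im⁻¹ := fun z hz => by
    refine (norm_sub_le _ _).trans ?_
    rw [norm_one, norm_mul, Complex.norm_I, one_mul]
    have := norm_resolventTransform_le (μ := μ) (z := e + z) (by simpa using hz)
    simpa using this
  have harg : ∀ z : ℂ, 0 < z.im → |(w z).arg| ≤ Real.pi / 2 := fun z hz =>
    Complex.abs_arg_le_pi_div_two_iff.2 (by linarith [hre1 z hz])
  have hwd : DifferentiableOn ℂ w {z | 0 < z.im} := by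
    refine (differentiableOn_const _).sub ((differentiableOn_const _).mul ?_)
    refine (differentiableOn_resolventTransform (μ := μ)).comp (by fun_prop) fun z hz => ?_
    simpa using hz
  have key := re_sub_re_le_of_im_tendsto_zero (F := fun z => Complex.log (w z))
    (hwd.clog fun z hz => Or.inl (by linarith [hre1 z hz])) ?_ ?_ ha hb ?_ hy hy1
  · simp only [Complex.log_re] at key
    have h1 : ‖w Complex.I‖ ≤ 2 := (hnorm2 _ (by simp)).trans (by simp; norm_num)
    have h1' := Real.log_le_log (by linarith [hnorm1 Complex.I (by simp)]) h1
    have hyI : 0 < ((y : ℂ) * Complex.I).im := by simpa using hy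
    have h2 : (resolventTransform μ ((e : ℂ) + y * Complex.I)).im ≤ ‖w (y * Complex.I)‖ := by
      have := Complex.re_le_norm (w (y * Complex.I))
      rw [hre] at this
      linarith
    refine h2.trans ?_
    have hX : 0 < ((a ^ 2 + 1) / (a ^ 2 + y ^ 2)) * ((b ^ 2 + 1) / (b ^ 2 + y ^ 2)) := by
      positivity
    rw [← Real.log_le_log_iff (by linarith [hnorm1 _ hyI]) (by positivity),
      Real.log_mul two_ne_zero (by positivity), Real.log_rpow hX,
      Real.log_mul (by positivity) (by positivity)]
    linarith
  · intro η hη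
    refine ⟨Real.log (1 + η⁻¹) + Real.pi / 2, fun z hz => ?_⟩
    have hz0 : 0 < z.im := hη.trans_le hz
    refine (Complex.norm_le_abs_re_add_abs_im _).trans ?_
    rw [Complex.log_re, Complex.log_im]
    refine add_le_add ?_ (harg z hz0)
    rw [abs_of_nonneg (Real.log_nonneg (hnorm1 z hz0))]
    refine Real.log_le_log (by linarith [hnorm1 z hz0]) ((hnorm2 z hz0).trans ?_)
    gcongr
  · intro z hz
    rw [Complex.log_im]
    exact harg z hz
  · have h := (measurePreserving_add_left volume e).quasiMeasurePreserving.ae hrefl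
    filter_upwards [h] with t ht hts
    obtain ⟨l, hl, hl0⟩ := ht ⟨by linarith [hts.1], by linarith [hts.2]⟩
    have h1 : Tendsto (fun η : ℝ => w (t + η * Complex.I)) (𝓝[>] 0) (𝓝 (1 - Complex.I * l)) := by
      refine tendsto_const_nhds.sub (tendsto_const_nhds.mul ?_)
      refine hl.congr fun η => ?_
      push_cast
      ring_nf
    -- The limit of `w` is real and at least `1`, so its argument is zero.
    have h1re : 1 ≤ (1 - Complex.I * l).re := by
      refine ge_of_tendsto ((Complex.continuous_re.tendsto _).comp h1) ?_
      filter_upwards [self_mem_nhdsWithin] with η hη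
      exact hre1 _ (by simpa using hη)
    have h1im : (1 - Complex.I * l).im = 0 := by simp [hl0]
    have h2 := h1.clog (Or.inl (by linarith))
    have h3 := (Complex.continuous_im.tendsto _).comp h2
    have h4 : (Complex.log (1 - Complex.I * l)).im = 0 := by
      rw [Complex.log_im, Complex.arg_eq_zero_iff]
      exact ⟨by linarith, h1im⟩
    rwa [h4] at h3

/-- Version of `resolventTransform_im_le` in terms of a lower bound `δ` for the distances of the
point `e + i d` to the endpoints of the band `[α, β]`. -/
theorem resolventTransform_im_le_rpow [IsProbabilityMeasure μ] {α β e d δ D : ℝ} (hαβ : α < β)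
    (he : e ∈ Set.Icc α β)
    (hrefl : ∀ᵐ x : ℝ, x ∈ Set.Icc α β → ∃ l : ℂ,
      Tendsto (fun y : ℝ => resolventTransform μ ((x : ℂ) + (y : ℂ) * Complex.I)) (𝓝[>] 0) (𝓝 l) ∧
        l.re = 0) (hd : 0 < d) (hδ : 0 < δ) (hδD : δ ≤ D)
    (hδα : δ ^ 2 ≤ (e - α) ^ 2 + d ^ 2) (hδβ : δ ^ 2 ≤ (β - e) ^ 2 + d ^ 2) {s : ℝ} (hs : d ≤ s) :
    (resolventTransform μ ((e : ℂ) + s * Complex.I)).im ≤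
      (2 * (4 * ((β - α) ^ 2 + 1) ^ 2 / (β - α) ^ 2) ^ (1 / 4 : ℝ) + D ^ (1 / 2 : ℝ)) /
        δ ^ (1 / 2 : ℝ) := by
  have hs0 : 0 < s := hd.trans_le hs
  have hL : 0 < β - α := by linarith
  rcases lt_or_ge s 1 with hs1 | hs1
  -- Heights below `1` use the reflectionless bound. From height `1` on, `|m| ≤ 1` suffices, and the
  -- summand with `D` in the constant covers that case.
  · obtain ⟨ha, hb⟩ := he
    have h := resolventTransform_im_le (μ := μ) (e := e) (a := e - α) (b := β - e) (y := s)
      (by linarith) (by linarith) (by simpa using hrefl) hs0 hs1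
    refine h.trans ?_
    rw [add_div (2 * _)]
    have hD : 0 ≤ D ^ (1 / 2 : ℝ) / δ ^ (1 / 2 : ℝ) := by
      have : 0 ≤ D := hδ.le.trans hδD
      positivity
    refine le_add_of_le_of_nonneg ?_ hD
    rw [mul_div_assoc]
    gcongr
    have hδ4 : δ ^ (1 / 2 : ℝ) = (δ ^ 2) ^ (1 / 4 : ℝ) := by
      rw [← Real.rpow_natCast, ← Real.rpow_mul hδ.le]
      norm_num
    rw [hδ4, ← Real.div_rpow (by positivity) (by positivity)]
    refine Real.rpow_le_rpow (by positivity) ?_ (by norm_num)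
    rw [div_mul_div_comm, div_div]
    set a := e - α with ha'
    set b := β - e with hb'
    have hab : β - α = a + b := by rw [ha', hb']; ring
    have ha0 : 0 ≤ a := by linarith
    have hb0 : 0 ≤ b := by linarith
    rw [hab] at hL ⊢
    have hds : d ^ 2 ≤ s ^ 2 := by gcongr
    have h1 : (a ^ 2 + 1) * (b ^ 2 + 1) ≤ ((a + b) ^ 2 + 1) ^ 2 := by
      rw [sq ((a + b) ^ 2 + 1)]
      gcongr <;> linarith
    -- The farther endpoint is at least half a band length away, so its factor is harmless; the
    -- nearer one supplies `δ ^ 2`. The fourth root of `δ ^ (-2)` is the exponent `-1/2`.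
    have h2 : (a + b) ^ 2 * δ ^ 2 ≤ 4 * ((a ^ 2 + s ^ 2) * (b ^ 2 + s ^ 2)) := by
      rcases le_total a b with hle | hle
      · calc (a + b) ^ 2 * δ ^ 2 ≤ (2 * b) ^ 2 * (a ^ 2 + s ^ 2) := by
              gcongr <;> linarith
          _ = 4 * ((a ^ 2 + s ^ 2) * b ^ 2) := by ring
          _ ≤ _ := by gcongr; nlinarith
      · calc (a + b) ^ 2 * δ ^ 2 ≤ (2 * a) ^ 2 * (b ^ 2 + s ^ 2) := by
              gcongr <;> linarith
          _ = 4 * (a ^ 2 * (b ^ 2 + s ^ 2)) := by ring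
          _ ≤ _ := by gcongr; nlinarith
    rw [div_le_div_iff₀ (by positivity) (by positivity)]
    calc (a ^ 2 + 1) * (b ^ 2 + 1) * ((a + b) ^ 2 * δ ^ 2)
        ≤ ((a + b) ^ 2 + 1) ^ 2 * (4 * ((a ^ 2 + s ^ 2) * (b ^ 2 + s ^ 2))) := by gcongr
      _ = _ := by ring
  · have h1 : (resolventTransform μ ((e : ℂ) + s * Complex.I)).im ≤ 1 := by
      refine (Complex.im_le_norm _).trans ?_
      have h := norm_resolventTransform_le (μ := μ) (z := (e : ℂ) + s * Complex.I)
        (by simpa using hs0)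
      have : s⁻¹ ≤ 1 := inv_le_one_of_one_le₀ hs1
      simp at h
      linarith
    refine h1.trans ?_
    rw [one_le_div (by positivity)]
    refine le_add_of_nonneg_of_le (by positivity) ?_
    gcongr

end ResolventTransform

/-! ### From Poisson integrals to negative powers of the distance -/

/-- Negative powers are controlled by averages of Poisson kernels over heights. -/
theorem ofReal_rpow_neg_le_lintegral {p d x : ℝ} (hp : 0 ≤ p) (hd : 0 < d) :
    ENNReal.ofReal (√(x ^ 2 + d ^ 2) ^ (-p)) ≤ ENNReal.ofReal (5 * 2 ^ p) *
      ∫⁻ s in Set.Ioi d, ENNReal.ofReal (s ^ (-p) * (s / (x ^ 2 + s ^ 2))) := by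
  set r := √(x ^ 2 + d ^ 2) with hr
  have hr2 : r ^ 2 = x ^ 2 + d ^ 2 := Real.sq_sqrt (by positivity)
  have hdr : d ≤ r := Real.le_sqrt_of_sq_le (by nlinarith [sq_nonneg x])
  have hr0 : 0 < r := hd.trans_le hdr
  -- Only heights `r < s ≤ 2 r` are kept. There `s ^ (-p) ≥ (2 r) ^ (-p)` and `x ^ 2 + s ^ 2 ≤ 5 r ^
  -- 2`, which yields the constant `5 * 2 ^ p`.
  have h1 : ENNReal.ofReal ((2 * r) ^ (-p) * (r / (5 * r ^ 2))) * ENNReal.ofReal r ≤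
      ∫⁻ s in Set.Ioi d, ENNReal.ofReal (s ^ (-p) * (s / (x ^ 2 + s ^ 2))) := by
    calc ENNReal.ofReal ((2 * r) ^ (-p) * (r / (5 * r ^ 2))) * ENNReal.ofReal r
        = ∫⁻ _ in Set.Ioc r (2 * r), ENNReal.ofReal ((2 * r) ^ (-p) * (r / (5 * r ^ 2))) := by
          rw [setLIntegral_const, Real.volume_Ioc]
          congr 2
          ring
      _ ≤ ∫⁻ s in Set.Ioc r (2 * r), ENNReal.ofReal (s ^ (-p) * (s / (x ^ 2 + s ^ 2))) := by
          refine setLIntegral_mono' measurableSet_Ioc fun s hs => ENNReal.ofReal_le_ofReal ?_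
          have hs0 : 0 < s := hr0.trans hs.1
          refine mul_le_mul ?_ ?_ (by positivity) (by positivity)
          · exact Real.rpow_le_rpow_of_nonpos hs0 hs.2 (by linarith)
          · refine div_le_div₀ hs0.le hs.1.le (by positivity) ?_
            nlinarith [hs.1, hs.2, sq_nonneg d]
      _ ≤ _ := lintegral_mono_set fun s hs => hdr.trans_lt hs.1
  calc ENNReal.ofReal (r ^ (-p))
      = ENNReal.ofReal (5 * 2 ^ p) *
        (ENNReal.ofReal ((2 * r) ^ (-p) * (r / (5 * r ^ 2))) * ENNReal.ofReal r) := by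
        rw [← ENNReal.ofReal_mul (by positivity), ← ENNReal.ofReal_mul (by positivity)]
        congr 1
        rw [Real.mul_rpow two_pos.le hr0.le, Real.rpow_neg two_pos.le]
        have : (2 : ℝ) ^ p ≠ 0 := by positivity
        field_simp
    _ ≤ _ := by gcongr

/-- A uniform bound for the Poisson integrals of a measure at heights above `d` bounds the
integral of the `p`-th negative power of the distance to the point `e + i d`. -/
theorem lintegral_rpow_neg_le_of_poisson_le {μ : Measure ℝ} [IsFiniteMeasure μ] {p d e B : ℝ}
    (hp : 1 < p) (hd : 0 < d) (hB : ∀ s : ℝ, d ≤ s → ∫ t, s / ((t - e) ^ 2 + s ^ 2) ∂μ ≤ B) :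
    ∫⁻ t, ENNReal.ofReal (√((t - e) ^ 2 + d ^ 2) ^ (-p)) ∂μ ≤
      ENNReal.ofReal (5 * 2 ^ p / (p - 1) * (B / d ^ (p - 1))) := by
  have hpois : ∀ s : ℝ, d ≤ s → ∫⁻ t, ENNReal.ofReal (s / ((t - e) ^ 2 + s ^ 2)) ∂μ ≤
      ENNReal.ofReal B := by
    intro s hs
    have hs0 : 0 < s := hd.trans_le hs
    have hint : Integrable (fun t => s / ((t - e) ^ 2 + s ^ 2)) μ := by
      refine Integrable.of_bound ?_ (s / s ^ 2) (Eventually.of_forall fun t => ?_)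
      · refine Measurable.aestronglyMeasurable ?_
        fun_prop
      · rw [Real.norm_eq_abs, abs_of_nonneg (by positivity)]
        gcongr
        nlinarith [sq_nonneg (t - e)]
    rw [← ofReal_integral_eq_lintegral_ofReal hint
      (Eventually.of_forall fun t => by positivity)]
    exact ENNReal.ofReal_le_ofReal (hB s hs)
  have hB0 : 0 ≤ B := (integral_nonneg fun t => by positivity).trans (hB d le_rfl)
  -- Tonelli exchanges the integrals over `t` and `s`; then `s ^ (-p)` integrates over `(d, ∞)` to
  -- `d ^ (1 - p) / (p - 1)`.
  calc ∫⁻ t, ENNReal.ofReal (√((t - e) ^ 2 + d ^ 2) ^ (-p)) ∂μ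
      ≤ ∫⁻ t, ENNReal.ofReal (5 * 2 ^ p) * (∫⁻ s in Set.Ioi d,
          ENNReal.ofReal (s ^ (-p) * (s / ((t - e) ^ 2 + s ^ 2)))) ∂μ :=
        lintegral_mono fun t => ofReal_rpow_neg_le_lintegral (by linarith) hd
    _ = ENNReal.ofReal (5 * 2 ^ p) * ∫⁻ s in Set.Ioi d, ∫⁻ t,
          ENNReal.ofReal (s ^ (-p) * (s / ((t - e) ^ 2 + s ^ 2))) ∂μ := by
        rw [lintegral_const_mul' _ _ ENNReal.ofReal_ne_top, lintegral_lintegral_swap]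
        refine Measurable.aemeasurable ?_
        unfold Function.uncurry
        fun_prop
    _ ≤ ENNReal.ofReal (5 * 2 ^ p) * ∫⁻ s in Set.Ioi d, ENNReal.ofReal (s ^ (-p) * B) := by
        refine mul_le_mul_right ?_ _
        refine setLIntegral_mono' measurableSet_Ioi fun s hs => ?_
        have hs0 : 0 < s := hd.trans hs
        simp only [ENNReal.ofReal_mul (by positivity : 0 ≤ s ^ (-p))]
        rw [lintegral_const_mul' _ _ ENNReal.ofReal_ne_top]
        gcongr
        exact hpois s (le_of_lt hs)
    _ = _ := by
        rw [← ofReal_integral_eq_lintegral_ofReal, integral_mul_const,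
          integral_Ioi_rpow_of_lt (by linarith) hd, ← ENNReal.ofReal_mul (by positivity)]
        · congr 1
          have h : -p + 1 = -(p - 1) := by ring
          rw [h, Real.rpow_neg hd.le]
          have : p - 1 ≠ 0 := by linarith
          have : d ^ (p - 1) ≠ 0 := by positivity
          field_simp
        · exact (integrableOn_Ioi_rpow_of_lt (by linarith) hd).mul_const B
        · refine (ae_restrict_iff' measurableSet_Ioi).2 (Eventually.of_forall fun s hs => ?_)
          have hs0 : 0 < s := hd.trans hs
          simp only [Pi.zero_apply]
          positivity

/-! ### Finite gap sets and the final estimates -/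

namespace FiniteGapSet

variable (E : FiniteGapSet)

theorem isCompact_carrier : IsCompact E.carrier :=
  isCompact_iUnion fun _ => isCompact_Icc

theorem endpoints_subset_carrier : E.endpoints ⊆ E.carrier := by
  rintro x (⟨n, rfl⟩ | ⟨n, rfl⟩)
  · exact Set.mem_iUnion.2 ⟨n, le_rfl, (E.α_lt_β n).le⟩
  · exact Set.mem_iUnion.2 ⟨n, (E.α_lt_β n).le, le_rfl⟩

theorem endpoints_nonempty : E.endpoints.Nonempty :=
  ⟨E.α ⟨0, E.one_le_N⟩, Or.inl ⟨_, rfl⟩⟩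

theorem isCompact_complexCarrier : IsCompact E.complexCarrier :=
  E.isCompact_carrier.image Complex.continuous_ofReal

theorem complexCarrier_nonempty : E.complexCarrier.Nonempty :=
  (E.endpoints_nonempty.mono E.endpoints_subset_carrier).image _

theorem exists_abs_le : ∃ R : ℝ, 0 ≤ R ∧ ∀ t ∈ E.carrier, |t| ≤ R := by
  obtain ⟨R, hR⟩ := E.isCompact_carrier.isBounded.exists_norm_le
  exact ⟨max R 0, le_max_right _ _, fun t ht => (hR t ht).trans (le_max_left _ _)⟩

theorem infDist_complexCarrier_pos {z : ℂ} (hz : z ∉ E.complexCarrier) :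
    0 < Metric.infDist z E.complexCarrier :=
  (E.isCompact_complexCarrier.isClosed.notMem_iff_infDist_pos E.complexCarrier_nonempty).1 hz

theorem infDist_complexEndpoints_pos {z : ℂ} (hz : z ∉ E.complexCarrier) :
    0 < Metric.infDist z E.complexEndpoints :=
  (E.infDist_complexCarrier_pos hz).trans_le (Metric.infDist_le_infDist_of_subset
    (Set.image_mono E.endpoints_subset_carrier) (E.endpoints_nonempty.image _))

theorem infDist_complexCarrier_le (z : ℂ) {t : ℝ} (ht : t ∈ E.carrier) :
    Metric.infDist z E.complexCarrier ≤ ‖(t : ℂ) - z‖ := by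
  rw [← dist_eq_norm, dist_comm]
  exact Metric.infDist_le_dist_of_mem ⟨t, ht, rfl⟩

theorem infDist_complexEndpoints_le (z : ℂ) {t : ℝ} (ht : t ∈ E.endpoints) :
    Metric.infDist z E.complexEndpoints ≤ ‖(t : ℂ) - z‖ := by
  rw [← dist_eq_norm, dist_comm]
  exact Metric.infDist_le_dist_of_mem ⟨t, ht, rfl⟩

/-- A nearest point of the finite gap set. -/
theorem exists_infDist_eq (z : ℂ) :
    ∃ e ∈ E.carrier, Metric.infDist z E.complexCarrier = ‖(e : ℂ) - z‖ := by
  obtain ⟨w, ⟨e, he, rfl⟩, h⟩ :=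
    E.isCompact_complexCarrier.exists_infDist_eq_dist E.complexCarrier_nonempty z
  exact ⟨e, he, by rw [h, dist_comm, dist_eq_norm]⟩

theorem restrict_carrier_eq {ρ : Measure ℝ} (hρ : ρ E.carrierᶜ = 0) :
    ρ.restrict E.carrier = ρ :=
  Measure.restrict_eq_self_of_ae_mem (mem_ae_iff.2 hρ)

theorem mFunction_eq_resolventTransform {ρ : Measure ℝ} (hρ : ρ E.carrierᶜ = 0) (z : ℂ) :
    E.mFunction ρ z = resolventTransform ρ z := by
  rw [mFunction, E.restrict_carrier_eq hρ, resolventTransform_eq_integral_inv]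
  simp only [one_div]

theorem integrable_one_div_norm_sub_rpow {ρ : Measure ℝ} [IsFiniteMeasure ρ]
    (hρ : ρ E.carrierᶜ = 0) {z : ℂ} (hz : z ∉ E.complexCarrier) {p : ℝ} (hp : 0 ≤ p) :
    Integrable (fun t : ℝ => 1 / ‖(t : ℂ) - z‖ ^ p) ρ := by
  have hd := E.infDist_complexCarrier_pos hz
  refine Integrable.of_bound (Measurable.aestronglyMeasurable (by fun_prop))
    (1 / Metric.infDist z E.complexCarrier ^ p) ?_
  filter_upwards [mem_ae_iff.2 hρ] with t ht
  rw [Real.norm_eq_abs, abs_of_nonneg (by positivity)]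
  gcongr
  exact E.infDist_complexCarrier_le z ht

/-- The integrand is at most `d ^ (-p)`, and for `d ≥ 1` both `δ` and `1 + ‖z‖` are at most constant
multiples of `d`, so one factor `d` absorbs their square roots. -/
theorem integral_one_div_norm_sub_rpow_le_of_one_le {ρ : Measure ℝ} [IsProbabilityMeasure ρ]
    (hρ : ρ E.carrierᶜ = 0) {z : ℂ} (hz : z ∉ E.complexCarrier) {p R : ℝ} (hp : 1 < p)
    (hR0 : 0 ≤ R) (hR : ∀ t ∈ E.carrier, |t| ≤ R)
    (hd1 : 1 ≤ Metric.infDist z E.complexCarrier) :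
    ∫ t : ℝ, 1 / ‖(t : ℂ) - z‖ ^ p ∂ρ ≤ ((1 + 2 * R) * (R + 2)) ^ (1 / 2 : ℝ) /
      (Metric.infDist z E.complexCarrier ^ (p - 1) *
        Metric.infDist z E.complexEndpoints ^ (1 / 2 : ℝ) * (1 + ‖z‖) ^ (1 / 2 : ℝ)) := by
  obtain ⟨e, he, hde⟩ := E.exists_infDist_eq z
  set d := Metric.infDist z E.complexCarrier with hd
  set δ := Metric.infDist z E.complexEndpoints with hδ
  have hd0 : 0 < d := by linarith
  have hδ0 : 0 < δ := E.infDist_complexEndpoints_pos hz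
  have h1 : ∫ t : ℝ, 1 / ‖(t : ℂ) - z‖ ^ p ∂ρ ≤ 1 / d ^ p := by
    have h := norm_integral_le_of_norm_le_const (μ := ρ)
      (f := fun t : ℝ => 1 / ‖(t : ℂ) - z‖ ^ p) (C := 1 / d ^ p) (by
        filter_upwards [mem_ae_iff.2 hρ] with t ht
        rw [Real.norm_eq_abs, abs_of_nonneg (by positivity)]
        gcongr
        exact E.infDist_complexCarrier_le z ht)
    simp only [probReal_univ, mul_one] at h
    exact (le_abs_self _).trans h
  refine h1.trans ?_
  have hze : ‖z‖ ≤ R + d := by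
    have := norm_sub_le (e : ℂ) ((e : ℂ) - z)
    rw [sub_sub_cancel, Complex.norm_real, Real.norm_eq_abs, ← hde] at this
    linarith [hR e he]
  obtain ⟨x, hx⟩ := E.endpoints_nonempty
  have hδd : δ ≤ (1 + 2 * R) * d := by
    have h3 : δ ≤ ‖(x : ℂ) - z‖ := E.infDist_complexEndpoints_le z hx
    have h4 := norm_sub_le (x : ℂ) z
    rw [Complex.norm_real, Real.norm_eq_abs] at h4
    have h5 := hR x (E.endpoints_subset_carrier hx)
    nlinarith
  have hzd : 1 + ‖z‖ ≤ (R + 2) * d := by nlinarith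
  rw [div_le_div_iff₀ (by positivity) (by positivity), one_mul, mul_assoc,
    ← Real.mul_rpow hδ0.le (by positivity)]
  have h6 : (δ * (1 + ‖z‖)) ^ (1 / 2 : ℝ) ≤ ((1 + 2 * R) * (R + 2)) ^ (1 / 2 : ℝ) * d := by
    calc (δ * (1 + ‖z‖)) ^ (1 / 2 : ℝ)
        ≤ (((1 + 2 * R) * d) * ((R + 2) * d)) ^ (1 / 2 : ℝ) := by gcongr
      _ = (((1 + 2 * R) * (R + 2)) * d ^ 2) ^ (1 / 2 : ℝ) := by ring_nf
      _ = _ := by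
        rw [Real.mul_rpow (by positivity) (by positivity), ← Real.sqrt_eq_rpow (d ^ 2),
          Real.sqrt_sq hd0.le]
  calc d ^ (p - 1) * (δ * (1 + ‖z‖)) ^ (1 / 2 : ℝ)
      ≤ d ^ (p - 1) * (((1 + 2 * R) * (R + 2)) ^ (1 / 2 : ℝ) * d) := by gcongr
    _ = ((1 + 2 * R) * (R + 2)) ^ (1 / 2 : ℝ) * d ^ p := by
      rw [Real.rpow_sub_one hd0.ne']
      field_simp

/-- The point `z` is replaced by `e + i d`, which lies directly above a nearest point `e` of `E`.
This changes distances to `E` and to the endpoints only by constant factors, and `1 + ‖z‖` is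
bounded. -/
theorem integral_one_div_norm_sub_rpow_le_of_lt_one {ρ : Measure ℝ} [IsProbabilityMeasure ρ]
    (hρ : ρ E.carrierᶜ = 0) (hrefl : E.IsReflectionless ρ) {z : ℂ} (hz : z ∉ E.complexCarrier)
    {p R C : ℝ} (hp : 1 < p) (hR0 : 0 ≤ R) (hR : ∀ t ∈ E.carrier, |t| ≤ R)
    (hC : ∀ n, (4 * ((E.β n - E.α n) ^ 2 + 1) ^ 2 / (E.β n - E.α n) ^ 2) ^ (1 / 4 : ℝ) ≤ C)
    (hd1 : Metric.infDist z E.complexCarrier < 1) :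
    ∫ t : ℝ, 1 / ‖(t : ℂ) - z‖ ^ p ∂ρ ≤
      3 ^ p * (5 * 2 ^ p / (p - 1) * ((2 * C + (1 + 2 * R) ^ (1 / 2 : ℝ)) * 2 ^ (1 / 2 : ℝ))) *
          (R + 2) ^ (1 / 2 : ℝ) /
      (Metric.infDist z E.complexCarrier ^ (p - 1) *
        Metric.infDist z E.complexEndpoints ^ (1 / 2 : ℝ) * (1 + ‖z‖) ^ (1 / 2 : ℝ)) := by
  obtain ⟨e, he, hde⟩ := E.exists_infDist_eq z
  obtain ⟨n, hen⟩ := Set.mem_iUnion.1 he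
  have hd0 := E.infDist_complexCarrier_pos hz
  have hδ0 := E.infDist_complexEndpoints_pos hz
  have hdt : ∀ t ∈ E.carrier, Metric.infDist z E.complexCarrier ≤ ‖(t : ℂ) - z‖ :=
    fun t ht => E.infDist_complexCarrier_le z ht
  have hδt : ∀ x ∈ E.endpoints, Metric.infDist z E.complexEndpoints ≤ ‖(x : ℂ) - z‖ :=
    fun x hx => E.infDist_complexEndpoints_le z hx
  set d := Metric.infDist z E.complexCarrier with hd
  set δ := Metric.infDist z E.complexEndpoints with hδ
  have hC0 : 0 ≤ C := le_trans (by positivity) (hC n)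
  have htri : ∀ x : ℝ, ‖(x : ℂ) - z‖ ≤ |x - e| + d := fun x => by
    have := norm_add_le ((x : ℂ) - e) ((e : ℂ) - z)
    rw [sub_add_sub_cancel, ← hde, ← Complex.ofReal_sub, Complex.norm_real,
      Real.norm_eq_abs] at this
    exact this
  -- Passing from `z` to `e + i d` costs a constant, by `(u + v) ^ 2 ≤ 2 (u ^ 2 + v ^ 2)`; hence `δ
  -- / 2` replaces `δ`.
  have hsq : ∀ x ∈ E.endpoints, (δ / 2) ^ 2 ≤ (x - e) ^ 2 + d ^ 2 := fun x hx => by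
    have h1 : δ ≤ |x - e| + d := (hδt x hx).trans (htri x)
    have h2 : δ ^ 2 ≤ (|x - e| + d) ^ 2 := by gcongr
    nlinarith [sq_abs (x - e), sq_nonneg (|x - e| - d)]
  have hαm : E.α n ∈ E.endpoints := Or.inl ⟨n, rfl⟩
  have hβm : E.β n ∈ E.endpoints := Or.inr ⟨n, rfl⟩
  have hδD : δ / 2 ≤ 1 + 2 * R := by
    have h1 := (hδt _ hαm).trans (htri _)
    have h2 := abs_sub (E.α n) e
    have h3 := hR _ (E.endpoints_subset_carrier hαm)
    have h4 := hR e he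
    linarith
  have hzR : 1 + ‖z‖ ≤ R + 2 := by
    have := norm_sub_le (e : ℂ) ((e : ℂ) - z)
    rw [sub_sub_cancel, Complex.norm_real, Real.norm_eq_abs, ← hde] at this
    linarith [hR e he]
  have hrefl' : ∀ᵐ x : ℝ, x ∈ Set.Icc (E.α n) (E.β n) → ∃ l : ℂ,
      Tendsto (fun y : ℝ => resolventTransform ρ ((x : ℂ) + (y : ℂ) * Complex.I)) (𝓝[>] 0) (𝓝 l) ∧
        l.re = 0 := by
    have h := (ae_restrict_iff' E.isCompact_carrier.measurableSet).1 hrefl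
    filter_upwards [h] with x hx hxn
    simpa only [E.mFunction_eq_resolventTransform hρ] using hx (Set.mem_iUnion.2 ⟨n, hxn⟩)
  set B := (2 * C + (1 + 2 * R) ^ (1 / 2 : ℝ)) / (δ / 2) ^ (1 / 2 : ℝ) with hB
  have hpois : ∀ s : ℝ, d ≤ s → ∫ t, s / ((t - e) ^ 2 + s ^ 2) ∂ρ ≤ B := by
    intro s hs
    have hs0 : 0 < s := hd0.trans_le hs
    have h := resolventTransform_im_le_rpow (μ := ρ) (E.α_lt_β n) hen hrefl' hd0
      (half_pos hδ0) hδD (by simpa only [sub_sq_comm] using hsq _ hαm) (hsq _ hβm) hs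
    rw [resolventTransform_im (by simpa using hs0)] at h
    simp only [Complex.add_re, Complex.ofReal_re, Complex.mul_re, Complex.I_re, mul_zero,
      Complex.ofReal_im, Complex.I_im, mul_one, sub_self, add_zero, Complex.add_im,
      Complex.mul_im, zero_add] at h
    refine h.trans ?_
    rw [hB]
    gcongr
    exact hC n
  have hB0 : 0 ≤ B := by positivity
  have hmain : ∫ t : ℝ, 1 / ‖(t : ℂ) - z‖ ^ p ∂ρ ≤
      3 ^ p * (5 * 2 ^ p / (p - 1) * (B / d ^ (p - 1))) := by
    rw [integral_eq_lintegral_of_nonneg_ae (Eventually.of_forall fun t => by positivity)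
      (E.integrable_one_div_norm_sub_rpow hρ hz (by linarith)).aestronglyMeasurable]
    have hp1 : 0 < p - 1 := by linarith
    refine ENNReal.toReal_le_of_le_ofReal (by positivity) ?_
    rw [ENNReal.ofReal_mul (by positivity)]
    refine le_trans ?_ (mul_le_mul_right (lintegral_rpow_neg_le_of_poisson_le hp hd0 hpois) _)
    rw [← lintegral_const_mul' _ _ ENNReal.ofReal_ne_top]
    refine lintegral_mono_ae ?_
    filter_upwards [mem_ae_iff.2 hρ] with t ht
    rw [← ENNReal.ofReal_mul (by positivity)]
    refine ENNReal.ofReal_le_ofReal ?_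
    have hn0 : 0 < ‖(t : ℂ) - z‖ := hd0.trans_le (hdt t ht)
    -- Because `e` is nearest, `|t - e| ≤ 2 ‖t - z‖` and `d ≤ ‖t - z‖`, and `√5 ≤ 3`.
    have hr : √((t - e) ^ 2 + d ^ 2) ≤ 3 * ‖(t : ℂ) - z‖ := by
      rw [Real.sqrt_le_left (by positivity)]
      have h1 := norm_sub_le ((t : ℂ) - z) ((e : ℂ) - z)
      rw [sub_sub_sub_cancel_right, ← hde, ← Complex.ofReal_sub, Complex.norm_real,
        Real.norm_eq_abs] at h1
      have h2 := hdt t ht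
      have h3 : |t - e| ≤ 2 * ‖(t : ℂ) - z‖ := by linarith
      have h4 : (t - e) ^ 2 ≤ (2 * ‖(t : ℂ) - z‖) ^ 2 := by
        rw [← sq_abs]; gcongr
      have h5 : d ^ 2 ≤ ‖(t : ℂ) - z‖ ^ 2 := by gcongr
      nlinarith
    have hr0 : 0 < √((t - e) ^ 2 + d ^ 2) := by positivity
    have h6 := Real.rpow_le_rpow_of_nonpos hr0 hr (by linarith : -p ≤ 0)
    rw [Real.mul_rpow (by norm_num) hn0.le, Real.rpow_neg (by norm_num : (0 : ℝ) ≤ 3),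
      Real.rpow_neg hn0.le] at h6
    calc 1 / ‖(t : ℂ) - z‖ ^ p = 3 ^ p * ((3 ^ p)⁻¹ * (‖(t : ℂ) - z‖ ^ p)⁻¹) := by
          field_simp
      _ ≤ _ := by gcongr
  refine hmain.trans ?_
  have hz12 : (1 + ‖z‖) ^ (1 / 2 : ℝ) ≤ (R + 2) ^ (1 / 2 : ℝ) := by gcongr
  have hp1 : 0 < p - 1 := by linarith
  rw [le_div_iff₀ (by positivity)]
  calc 3 ^ p * (5 * 2 ^ p / (p - 1) * (B / d ^ (p - 1))) *
        (d ^ (p - 1) * δ ^ (1 / 2 : ℝ) * (1 + ‖z‖) ^ (1 / 2 : ℝ))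
      = 3 ^ p * (5 * 2 ^ p / (p - 1) * (B * δ ^ (1 / 2 : ℝ))) * (1 + ‖z‖) ^ (1 / 2 : ℝ) := by
        field_simp
    _ = 3 ^ p * (5 * 2 ^ p / (p - 1) *
          ((2 * C + (1 + 2 * R) ^ (1 / 2 : ℝ)) * 2 ^ (1 / 2 : ℝ))) * (1 + ‖z‖) ^ (1 / 2 : ℝ) := by
        congr 3
        rw [hB, Real.div_rpow hδ0.le two_pos.le]
        field_simp
    _ ≤ _ := by gcongr

theorem exists_integral_one_div_norm_sub_rpow_le {p : ℝ} (hp : 1 < p) :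
    ∃ K : ℝ, ∀ (ρ : Measure ℝ) [IsProbabilityMeasure ρ],
      ρ E.carrierᶜ = 0 → E.IsReflectionless ρ → ∀ z : ℂ, z ∉ E.complexCarrier →
        ∫ t : ℝ, 1 / ‖(t : ℂ) - z‖ ^ p ∂ρ ≤
          K / (Metric.infDist z E.complexCarrier ^ (p - 1) *
            Metric.infDist z E.complexEndpoints ^ (1 / 2 : ℝ) * (1 + ‖z‖) ^ (1 / 2 : ℝ)) := by
  obtain ⟨R, hR0, hR⟩ := E.exists_abs_le
  -- There are finitely many bands, so one constant, depending only on `E`, serves for all of them.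
  obtain ⟨C, hC⟩ := Finite.exists_le fun n : Fin E.N =>
    (4 * ((E.β n - E.α n) ^ 2 + 1) ^ 2 / (E.β n - E.α n) ^ 2) ^ (1 / 4 : ℝ)
  refine ⟨max (3 ^ p * (5 * 2 ^ p / (p - 1) * ((2 * C + (1 + 2 * R) ^ (1 / 2 : ℝ)) *
    2 ^ (1 / 2 : ℝ))) * (R + 2) ^ (1 / 2 : ℝ)) (((1 + 2 * R) * (R + 2)) ^ (1 / 2 : ℝ)), fun ρ _ hρ hrefl z hz => ?_⟩
  have hd := E.infDist_complexCarrier_pos hz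
  have hδ := E.infDist_complexEndpoints_pos hz
  rcases lt_or_ge (Metric.infDist z E.complexCarrier) 1 with h1 | h1
  · refine (E.integral_one_div_norm_sub_rpow_le_of_lt_one hρ hrefl hz hp hR0 hR hC h1).trans ?_
    gcongr
    exact le_max_left _ _
  · refine (E.integral_one_div_norm_sub_rpow_le_of_one_le hρ hz hp hR0 hR h1).trans ?_
    gcongr
    exact le_max_right _ _

/-- Apply the case `p = 1 + ε`. The surplus `‖t - z‖ ^ ε` is at most `((1 + R) (1 + ‖z‖)) ^ ε` on
`E`, which accounts for the weaker exponent `1 / 2 - ε`. -/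
theorem exists_integral_one_div_norm_sub_le {ε : ℝ} (hε : 0 < ε) :
    ∃ K : ℝ, ∀ (ρ : Measure ℝ) [IsProbabilityMeasure ρ],
      ρ E.carrierᶜ = 0 → E.IsReflectionless ρ → ∀ z : ℂ, z ∉ E.complexCarrier →
        ∫ t : ℝ, 1 / ‖(t : ℂ) - z‖ ∂ρ ≤
          K / (Metric.infDist z E.complexCarrier ^ ε *
            Metric.infDist z E.complexEndpoints ^ (1 / 2 : ℝ) *
              (1 + ‖z‖) ^ (1 / 2 - ε : ℝ)) := by
  obtain ⟨K, hK⟩ := E.exists_integral_one_div_norm_sub_rpow_le (p := 1 + ε) (by linarith)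
  obtain ⟨R, hR0, hR⟩ := E.exists_abs_le
  refine ⟨(1 + R) ^ ε * K, fun ρ _ hρ hrefl z hz => ?_⟩
  have hd := E.infDist_complexCarrier_pos hz
  have hδ := E.infDist_complexEndpoints_pos hz
  have h1 : ∫ t : ℝ, 1 / ‖(t : ℂ) - z‖ ∂ρ ≤
      ∫ t : ℝ, ((1 + R) * (1 + ‖z‖)) ^ ε * (1 / ‖(t : ℂ) - z‖ ^ (1 + ε)) ∂ρ := by
    refine integral_mono_ae ?_
      ((E.integrable_one_div_norm_sub_rpow hρ hz (by linarith)).const_mul _) ?_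
    · simpa only [Real.rpow_one] using E.integrable_one_div_norm_sub_rpow hρ hz zero_le_one
    · filter_upwards [mem_ae_iff.2 hρ] with t ht
      have hn0 : 0 < ‖(t : ℂ) - z‖ := hd.trans_le (E.infDist_complexCarrier_le z ht)
      have hn : ‖(t : ℂ) - z‖ ≤ (1 + R) * (1 + ‖z‖) := by
        have h := norm_sub_le (t : ℂ) z
        rw [Complex.norm_real, Real.norm_eq_abs] at h
        nlinarith [hR t ht, norm_nonneg z]
      rw [Real.rpow_add hn0, Real.rpow_one]
      calc 1 / ‖(t : ℂ) - z‖ =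
            ‖(t : ℂ) - z‖ ^ ε * (1 / (‖(t : ℂ) - z‖ * ‖(t : ℂ) - z‖ ^ ε)) := by
            field_simp
        _ ≤ _ := by gcongr
  refine h1.trans ?_
  rw [integral_const_mul]
  refine (mul_le_mul_of_nonneg_left (hK ρ hρ hrefl z hz) (by positivity)).trans (le_of_eq ?_)
  rw [add_sub_cancel_left, Real.mul_rpow (by positivity) (by positivity),
    Real.rpow_sub (by positivity : 0 < 1 + ‖z‖)]
  field_simp

end FiniteGapSet

theorem theorem2p2 (E : FiniteGapSet) :
    (∀ p : ℝ, 1 < p → ∃ K : ℝ, ∀ (ρ : Measure ℝ) [IsProbabilityMeasure ρ],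
      ρ E.carrierᶜ = 0 → E.IsReflectionless ρ → ∀ z : ℂ, z ∉ E.complexCarrier →
        ∫ t in E.carrier, 1 / ‖(t : ℂ) - z‖ ^ p ∂ρ ≤
          K / (Metric.infDist z E.complexCarrier ^ (p - 1) *
            Metric.infDist z E.complexEndpoints ^ (1 / 2 : ℝ) * (1 + ‖z‖) ^ (1 / 2 : ℝ))) ∧
    (∀ ε : ℝ, 0 < ε → ∃ K : ℝ, ∀ (ρ : Measure ℝ) [IsProbabilityMeasure ρ],
      ρ E.carrierᶜ = 0 → E.IsReflectionless ρ → ∀ z : ℂ, z ∉ E.complexCarrier →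
        ∫ t in E.carrier, 1 / ‖(t : ℂ) - z‖ ∂ρ ≤
          K / (Metric.infDist z E.complexCarrier ^ ε *
            Metric.infDist z E.complexEndpoints ^ (1 / 2 : ℝ) *
              (1 + ‖z‖) ^ (1 / 2 - ε : ℝ))) := by
  refine ⟨fun p hp => ?_, fun ε hε => ?_⟩
  · obtain ⟨K, hK⟩ := E.exists_integral_one_div_norm_sub_rpow_le hp
    refine ⟨K, fun ρ _ hρ hrefl z hz => ?_⟩
    rw [E.restrict_carrier_eq hρ]
    exact hK ρ hρ hrefl z hz
  · obtain ⟨K, hK⟩ := E.exists_integral_one_div_norm_sub_le hε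
    refine ⟨K, fun ρ _ hρ hrefl z hz => ?_⟩
    rw [E.restrict_carrier_eq hρ]
    exact hK ρ hρ hrefl z hz
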